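/- A transformer here is a linear token embedding plus positional encodings, followed by layers of the form (multi-head softmax attention with a residual connection, then a feed-forward network with one hidden ReLU layer of arbitrary finite width with a residual connection). A prompt consists of $m\ge 1$ in-context examples $(x_1^{(j)},\dots,x_{n-2}^{(j)},\texttt{=},y^{(j)})$, $1\le j\le m$, each of length $n\ge 3$ with $x_i^{(j)},y^{(j)}\in\mathbb R^d$, followed by a query $(x_1,\dots,x_{n-2},\texttt{=})$; the equals sign is a fixed vector, and each token carries a flag coordinate that is $1$ for the equals sign and $0$ otherwise. A task $k\in\{1,\dots,K\}$, $K\ge 1$, is a place $i_k\in\{1,\dots,n-2\}$ with a function $g_k:\mathbb R^d\to\mathbb R^d$ that is continuous on the cube $[-R,R]^d$; its answer to $(x_1,\dots,x_{n-2})$ is $g_k(x_{i_k})$. For $\tau>0$ let $$p_k=\frac1m\sum_{j=1}^m \mathrm{ReLU}\bigl(1-\tau\,\|g_k(x_{i_k}^{(j)})-y^{(j)}\|_1\bigr)$$ be the average of the soft task indicators. **Theorem.** There is an absolute constant $C$ such that, for all $K,d,m,n$, all $R,B>0$, all tasks as above, every vector for the equals sign, all $\tau,\varepsilon>0$, each of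 the two weightings $w(p)=\frac{1}{1+e^{1-2p}}$ and $w(p)=p$, and attention either with or without causal masking, there is a transformer with seven layers, $K$ attention heads per layer, embedding dimension at most $C\,K\,(d+\log(mn))$ (that is, $O(d+\log(mn))$ for each of the $K$ parallel task streams) and positional encodings with entries in $\{-1,0,1\}$, such that for every prompt with inputs and query entries in $[-R,R]^d$ and labels in $[-B,B]^d$ the final column (at the equals sign of the query) of its output contains, in fixed coordinates and each up to an error of at most $\varepsilon$: 1. the task identifiers $p_k$ for all $k$; 2. the weighted predictions $w(p_k)\,g_k(x_{i_k})$ for all $k$; 3. their superposition $\sum_{k=1}^K w(p_k)\,g_k(x_{i_k})$. Moreover, if for some $k$ every example satisfies $y^{(j)}=g_k(x_{i_k}^{(j)})$ or $\|g_k(x_{i_k}^{(j)})-y^{(j)}\|_1\ge 1/\tau$, then $p_k$ is exactly the proportion of the in-context examples with $y^{(j)}=g_k(x_{i_k}^{(j)})$. -/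

import Mathlib

open scoped BigOperators

/-! ## Transformers (softmax attention, ReLU feed-forward layers, residual connections) -/

/-- One attention head acting on an embedding space of dimension `D`. -/
structure AttentionHead (D : ℕ) where
  WQ : Matrix (Fin D) (Fin D) ℝ
  WK : Matrix (Fin D) (Fin D) ℝ
  WV : Matrix (Fin D) (Fin D) ℝ

/-- One transformer layer with embedding dimension `D` and `H` attention heads, followed by a
feed-forward network with one hidden ReLU layer of `width` neurons. -/
structure TransformerLayer (D H : ℕ) where
  head : Fin H → AttentionHead D
  width : ℕ
  W₁ : Matrix (Fin width) (Fin D) ℝ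
  b₁ : Fin width → ℝ
  W₂ : Matrix (Fin D) (Fin width) ℝ
  b₂ : Fin D → ℝ

/-- A transformer with `N` layers, embedding dimension `D` and `H` heads per layer, reading
sequences of `L` tokens in `ℝ^κ`. -/
structure Transformer (N D H L : ℕ) (κ : Type) where
  /-- the linear token embedding, the same at all positions -/
  embedding : Matrix (Fin D) κ ℝ
  /-- the positional encodings, added to the embedded tokens -/
  position : Fin L → Fin D → ℝ
  layer : Fin N → TransformerLayer D H

/-- The positions that position `t` may attend to. -/
def attended {L : ℕ} (causal : Bool) (t : Fin L) : Finset (Fin L) :=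
  if causal = true then Finset.Iic t else Finset.univ

/-- The attention logit `⟨W_K x_s, W_Q x_t⟩` of key position `s` for query position `t`. -/
def AttentionHead.logit {D L : ℕ} (h : AttentionHead D) (X : Fin L → Fin D → ℝ)
    (t s : Fin L) : ℝ :=
  (h.WK.mulVec (X s)) ⬝ᵥ (h.WQ.mulVec (X t))

/-- The softmax weight that query position `t` puts on the key position `s ∈ attended causal t`. -/
noncomputable def AttentionHead.weight {D L : ℕ} (causal : Bool) (h : AttentionHead D)
    (X : Fin L → Fin D → ℝ) (t s : Fin L) : ℝ :=
  Real.exp (h.logit X t s) / ∑ r ∈ attended causal t, Real.exp (h.logit X t r)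

/-- The output of a head at position `t`. -/
noncomputable def AttentionHead.out {D L : ℕ} (causal : Bool) (h : AttentionHead D)
    (X : Fin L → Fin D → ℝ) (t : Fin L) : Fin D → ℝ :=
  ∑ s ∈ attended causal t, h.weight causal X t s • h.WV.mulVec (X s)

/-- The attention part of a layer: all heads in parallel, plus the residual connection. -/
noncomputable def TransformerLayer.attention {D H L : ℕ} (causal : Bool) (ℓ : TransformerLayer D H)
    (X : Fin L → Fin D → ℝ) : Fin L → Fin D → ℝ :=
  fun t => X t + ∑ i, (ℓ.head i).out causal X t

/-- The feed-forward part of a layer, applied to each column, plus the residual connection. -/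
noncomputable def TransformerLayer.feedForward {D H : ℕ} (ℓ : TransformerLayer D H)
    (x : Fin D → ℝ) : Fin D → ℝ :=
  x + (ℓ.W₂.mulVec (fun i => max 0 (ℓ.W₁.mulVec x i + ℓ.b₁ i)) + ℓ.b₂)

/-- A full layer. -/
noncomputable def TransformerLayer.apply {D H L : ℕ} (causal : Bool) (ℓ : TransformerLayer D H)
    (X : Fin L → Fin D → ℝ) : Fin L → Fin D → ℝ :=
  fun t => ℓ.feedForward (ℓ.attention causal X t)

/-- The matrix (column `t` is `T.run causal S t`) that the transformer computes from the token
sequence `S`. -/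
noncomputable def Transformer.run {N D H L : ℕ} {κ : Type} [Fintype κ] (causal : Bool)
    (T : Transformer N D H L κ) (S : Fin L → κ → ℝ) : Fin L → Fin D → ℝ :=
  (List.ofFn T.layer).foldl (fun X ℓ => ℓ.apply causal X)
    (fun t => T.embedding.mulVec (S t) + T.position t)

/-! ## Prompts and tasks -/

/-- `m` in-context examples `(x₁, …, x_ℓ, =, y)` of length `ℓ + 2` and a query
`(x₁, …, x_ℓ, =)`, all entries being vectors of dimension `d`. -/
structure Prompt (d m ℓ : ℕ) where
  input : Fin m → Fin ℓ → Fin d → ℝ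
  label : Fin m → Fin d → ℝ
  query : Fin ℓ → Fin d → ℝ

/-- The number of tokens of a prompt. -/
def promptLength (m ℓ : ℕ) : ℕ := m * (ℓ + 2) + (ℓ + 1)

/-- The final position: the equals sign of the query, where the prediction takes place. -/
def lastPosition (m ℓ : ℕ) : Fin (promptLength m ℓ) :=
  ⟨m * (ℓ + 2) + ℓ, by unfold promptLength; omega⟩

/-- An ordinary token: a vector, with the "equals" flag set to `0`. -/
def vectorToken {d : ℕ} (x : Fin d → ℝ) : Fin d ⊕ Unit → ℝ := Sum.elim x (fun _ => 0)

/-- The equals sign: a fixed vector, with the "equals" flag set to `1`. -/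
def equalsToken {d : ℕ} (e : Fin d → ℝ) : Fin d ⊕ Unit → ℝ := Sum.elim e (fun _ => 1)

/-- The token sequence of a prompt: the examples one after the other, then the query.
Position `t` is place `t % (ℓ + 2)` of example `t / (ℓ + 2)`, the query being number `m`. -/
def Prompt.tokens {d m ℓ : ℕ} (e : Fin d → ℝ) (P : Prompt d m ℓ) :
    Fin (promptLength m ℓ) → Fin d ⊕ Unit → ℝ := fun t =>
  if hr : t.val % (ℓ + 2) < ℓ then
    if hj : t.val / (ℓ + 2) < m then
      vectorToken (P.input ⟨t.val / (ℓ + 2), hj⟩ ⟨t.val % (ℓ + 2), hr⟩)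
    else vectorToken (P.query ⟨t.val % (ℓ + 2), hr⟩)
  else if t.val % (ℓ + 2) = ℓ then equalsToken e
  else
    if hj : t.val / (ℓ + 2) < m then vectorToken (P.label ⟨t.val / (ℓ + 2), hj⟩)
    else 0 -- does not occur

/-- The entries of the inputs and of the query lie in `[-R, R]`, those of the labels in
`[-B, B]`. -/
def Prompt.BoundedBy {d m ℓ : ℕ} (P : Prompt d m ℓ) (R B : ℝ) : Prop :=
  (∀ j i c, |P.input j i c| ≤ R) ∧ (∀ i c, |P.query i c| ≤ R) ∧ (∀ j c, |P.label j c| ≤ B)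

/-- A task: a function on vectors of dimension `d`, applied to the entry at a fixed place. -/
structure VecTask (d ℓ : ℕ) where
  place : Fin ℓ
  fn : (Fin d → ℝ) → (Fin d → ℝ)

/-- The cube `[-R, R]^d`. -/
def cube (d : ℕ) (R : ℝ) : Set (Fin d → ℝ) := {x | ∀ c, |x c| ≤ R}

/-- The answer of the task to `(x₁, …, x_ℓ)`. -/
def VecTask.answer {d ℓ : ℕ} (g : VecTask d ℓ) (x : Fin ℓ → Fin d → ℝ) : Fin d → ℝ := g.fn (x g.place)

/-- The `l₁` distance between the answer of the task and the label of example `j`. -/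
def VecTask.discrepancy {d m ℓ : ℕ} (g : VecTask d ℓ) (P : Prompt d m ℓ) (j : Fin m) : ℝ :=
  ∑ c, |g.answer (P.input j) c - P.label j c|

/-- The soft indicator `ReLU (1 - τ z)` of `z = 0`, for `z ≥ 0`. -/
noncomputable def softIndicator (τ z : ℝ) : ℝ := max 0 (1 - τ * z)

/-- The average over the in-context examples of the soft indicators of the task. -/
noncomputable def VecTask.softProportion {d m ℓ : ℕ} (τ : ℝ) (g : VecTask d ℓ) (P : Prompt d m ℓ) : ℝ :=
  (∑ j, softIndicator τ (g.discrepancy P j)) / m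

/-- The proportion of the in-context examples that are labelled by the task. -/
noncomputable def VecTask.proportion {d m ℓ : ℕ} (g : VecTask d ℓ) (P : Prompt d m ℓ) : ℝ :=
  (Set.ncard {j : Fin m | P.label j = g.answer (P.input j)} : ℝ) / m

/-- The weight `1 / (1 + e^{1 - 2p})` that a softmax over the two scores `p` and `1 - p` gives. -/
noncomputable def softmaxWeight (p : ℝ) : ℝ := 1 / (1 + Real.exp (1 - 2 * p))

/-! Two layers do all the work; the other five are idle. In the first, head `k`, reading from an
equals sign or a label, copies the entry at the place of task `k` in its own block. Positions are
coded by the `±1` binary digits of block number and place, so the logit is `β` times an overlap of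
digit vectors that is maximal only at the wanted position, and for large `β` the softmax is close to
a point mass. The feed-forward network then approximates the soft indicators, which are continuous
in the selected inputs and the token. In the second layer, attention to the label flag averages the
indicators at the final position, which gives the `p_k`; the feed-forward network approximates the
products `w(p_k) g_k(x_{i_k})` and their sum. All the positions sought lie at or before the reader,
so causal masking does not change the limits.

The networks come from universal approximation (`closure_shallowNets_eq_top`): by Stone–Weierstrass
the functions `exp (a · x)` span a dense subspace, and each of them is a ridge function, hence a
limit of piecewise linear ones. The errors compose because `exists_feedForward` tolerates perturbed
inputs and because `eventually_softmax_average` is uniform in the bounded values being averaged;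
thus `β` depends on bounds and not on the prompt. Binary digits account for the logarithm in the
dimension. -/

/-- The ramp that interpolates linearly between `0` at `0` and `1` at `1`. -/
noncomputable def ramp (x : ℝ) : ℝ := max 0 x - max 0 (x - 1)

theorem ramp_of_one_le {x : ℝ} (h : 1 ≤ x) : ramp x = 1 := by
  unfold ramp
  rw [max_eq_right (by linarith), max_eq_right (by linarith)]
  ring

theorem ramp_of_nonpos {x : ℝ} (h : x ≤ 0) : ramp x = 0 := by
  unfold ramp
  rw [max_eq_left h, max_eq_left (by linarith)]
  ring

theorem ramp_of_mem_Icc {x : ℝ} (h0 : 0 ≤ x) (h1 : x ≤ 1) : ramp x = x := by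
  unfold ramp
  rw [max_eq_right h0, max_eq_left (by linarith)]
  ring

/-- Piecewise linear interpolation of `f` at the nodes `a + i h`, `i ≤ N`, by ramps. -/
theorem abs_ramp_interpolation_sub_le (f : ℝ → ℝ) {a h ε : ℝ} (hh : 0 < h)
    (N : ℕ) (hf : ∀ u ∈ Set.Icc a (a + N * h), ∀ v ∈ Set.Icc a (a + N * h),
      |u - v| ≤ h → |f u - f v| ≤ ε) :
    ∀ u ∈ Set.Icc a (a + N * h),
      |f a + ∑ i ∈ Finset.range N,
        (f (a + (i + 1 : ℕ) * h) - f (a + i * h)) * ramp ((u - (a + i * h)) / h) - f u| ≤ 2 * ε := by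
  induction N with
  | zero =>
    intro u hu
    have hu' : u = a := by
      have := hu.1
      have := hu.2
      simp at this
      linarith
    have h0 := hf u hu u hu (by simpa using hh.le)
    subst hu'
    simp at h0 ⊢
    exact h0
  | succ N ih =>
    intro u hu
    have hN : a + N * h ≤ a + (N + 1 : ℕ) * h := by push_cast; nlinarith
    have haN : a ≤ a + N * h := by
      have : 0 ≤ (N : ℝ) * h := by positivity
      linarith
    have hsub : Set.Icc a (a + N * h) ⊆ Set.Icc a (a + (N + 1 : ℕ) * h) :=
      Set.Icc_subset_Icc_right hN
    rw [Finset.sum_range_succ]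
    rcases le_total u (a + N * h) with hle | hge
    · rw [ramp_of_nonpos (x := (u - (a + N * h)) / h)
        (div_nonpos_of_nonpos_of_nonneg (by linarith) hh.le)]
      have := ih (fun u hu v hv => hf u (hsub hu) v (hsub hv)) u ⟨hu.1, hle⟩
      simpa using this
    -- The ramps of the completed cells are saturated at `1`, so their increments telescope to `f (a
    -- + N * h) - f a`.
    · have hone : ∀ i ∈ Finset.range N, (f (a + (i + 1 : ℕ) * h) - f (a + i * h)) *
          ramp ((u - (a + i * h)) / h) = f (a + (i + 1 : ℕ) * h) - f (a + i * h) := by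
        intro i hi
        have hi' : (i : ℝ) + 1 ≤ N := by exact_mod_cast Finset.mem_range.mp hi
        rw [ramp_of_one_le, mul_one]
        rw [le_div_iff₀ hh]
        nlinarith
      rw [Finset.sum_congr rfl hone, Finset.sum_range_sub (fun i : ℕ => f (a + i * h))]
      have hu2 := hu.2
      push_cast at hu2
      set θ := (u - (a + N * h)) / h with hθ
      have h0 : 0 ≤ θ := div_nonneg (by linarith) hh.le
      have h1 : θ ≤ 1 := by rw [hθ, div_le_one hh]; linarith
      rw [ramp_of_mem_Icc h0 h1]
      have e1 := hf (a + N * h) ⟨haN, hN⟩ u hu (by rw [abs_le]; constructor <;> linarith)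
      have e2 := hf (a + (N + 1 : ℕ) * h) ⟨haN.trans hN, le_rfl⟩ (a + N * h) ⟨haN, hN⟩ (by
        rw [abs_le]; push_cast; constructor <;> linarith)
      have e3 : |(f (a + (N + 1 : ℕ) * h) - f (a + N * h)) * θ| ≤ ε := by
        rw [abs_mul, abs_of_nonneg h0]
        nlinarith [abs_nonneg (f (a + (N + 1 : ℕ) * h) - f (a + N * h))]
      -- The error is the oscillation from the last node to `u` plus a fraction `θ` of one
      -- increment, hence the factor `2`.
      have : f a + (f (a + N * h) - f (a + (0 : ℕ) * h) +
          (f (a + (N + 1 : ℕ) * h) - f (a + N * h)) * θ) - f u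
          = (f (a + N * h) - f u) + (f (a + (N + 1 : ℕ) * h) - f (a + N * h)) * θ := by
        simp; ring
      rw [this]
      exact (abs_add_le _ _).trans (by linarith)

/-! ### Universal approximation by one hidden ReLU layer -/

section UniversalApproximation

variable {κ : Type*} [Fintype κ] (S : Set (κ → ℝ))

/-- The linear functional `x ↦ a · x` on `S`. -/
noncomputable def dotOn (a : κ → ℝ) : C(S, ℝ) :=
  ⟨fun x => a ⬝ᵥ x.1, continuous_const.dotProduct continuous_subtype_val⟩

/-- A single ReLU neuron with weights `p.1` and bias `p.2` on `S`. -/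
noncomputable def neuronOn (p : (κ → ℝ) × ℝ) : C(S, ℝ) :=
  ⟨fun x => max 0 (p.1 ⬝ᵥ x.1 + p.2),
    continuous_const.max ((continuous_const.dotProduct continuous_subtype_val).add continuous_const)⟩

/-- The functions computed by networks with one hidden ReLU layer on `S`. -/
noncomputable def shallowNets : Submodule ℝ C(S, ℝ) := Submodule.span ℝ (Set.range (neuronOn S))

/-- The functions `x ↦ exp (a · x)` on `S`. -/
noncomputable def expDotOn : Submonoid C(S, ℝ) where
  carrier := Set.range fun a : κ → ℝ => (⟨fun x => Real.exp (dotOn S a x), by fun_prop⟩ : C(S, ℝ))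
  one_mem' := ⟨0, by ext x; simp [dotOn]⟩
  mul_mem' := by
    rintro _ _ ⟨a, rfl⟩ ⟨b, rfl⟩
    exact ⟨a + b, by ext x; simp [dotOn, Real.exp_add]⟩

variable {S}

/-- On a compact set the argument `a · x` stays in a bounded interval, so a ridge function needs
only one-dimensional piecewise linear interpolation, and a ramp is a difference of two neurons. -/
theorem ridge_mem_closure_shallowNets [CompactSpace S] (f : ℝ → ℝ) (hf : Continuous f)
    (a : κ → ℝ) :
    (⟨fun x => f (dotOn S a x), by fun_prop⟩ : C(S, ℝ)) ∈ (shallowNets S).topologicalClosure := by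
  rw [← SetLike.mem_coe, Submodule.topologicalClosure_coe, Metric.mem_closure_iff]
  intro ε hε
  obtain ⟨M, hM⟩ : ∃ M : ℝ, ∀ x, |dotOn S a x| ≤ M :=
    ⟨‖dotOn S a‖, fun x => (dotOn S a).norm_coe_le_norm x⟩
  -- The maximum with `1` keeps the interval nondegenerate even if the functional vanishes on `S`.
  set M' := max M 1
  have hM' : 0 < M' := lt_of_lt_of_le one_pos (le_max_right _ _)
  have huc : UniformContinuousOn f (Set.Icc (-M') M') :=
    isCompact_Icc.uniformContinuousOn_of_continuous hf.continuousOn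
  rw [Metric.uniformContinuousOn_iff_le] at huc
  -- Interpolation doubles the oscillation `ε / 4`; the resulting `ε / 2` leaves room for a strict
  -- inequality.
  obtain ⟨δ, hδ, huc⟩ := huc (ε / 4) (by positivity)
  obtain ⟨N, hN⟩ := exists_nat_gt (2 * M' / δ)
  have hN0 : (0 : ℝ) < N := lt_of_le_of_lt (by positivity) hN
  set h := 2 * M' / N with hh
  have hh0 : 0 < h := by positivity
  have hhδ : h ≤ δ := by
    rw [div_lt_iff₀ hδ] at hN
    rw [hh, div_le_iff₀ hN0]
    linarith
  have hend : -M' + N * h = M' := by rw [hh]; field_simp; ring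
  have key := abs_ramp_interpolation_sub_le f (a := -M') (h := h) (ε := ε / 4) hh0 N (by
    rw [hend]
    intro u hu v hv huv
    exact huc u hu v hv (huv.trans hhδ))
  rw [hend] at key
  have hneuron : ∀ p, neuronOn S p ∈ shallowNets S := fun p => Submodule.subset_span ⟨p, rfl⟩
  -- The neuron `(0, 1)` is the constant `1` and carries the initial value.
  refine ⟨f (-M') • neuronOn S (0, 1) + ∑ i ∈ Finset.range N,
    (f (-M' + (i + 1 : ℕ) * h) - f (-M' + i * h)) •
      (neuronOn S (h⁻¹ • a, -(-M' + i * h) / h) - neuronOn S (h⁻¹ • a, -(-M' + i * h) / h - 1)),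
    ?_, ?_⟩
  · refine Submodule.add_mem _ (Submodule.smul_mem _ _ (hneuron _)) (Submodule.sum_mem _ ?_)
    intro i _
    exact Submodule.smul_mem _ _ (Submodule.sub_mem _ (hneuron _) (hneuron _))
  · rw [dist_comm]
    refine lt_of_le_of_lt ((ContinuousMap.dist_le (by positivity : (0 : ℝ) ≤ ε / 2)).2 ?_)
      (by linarith)
    intro x
    have hx := key (dotOn S a x) (abs_le.mp ((hM x).trans (le_max_left _ _)))
    rw [Real.dist_eq]
    convert hx using 2
    · congr 1
      simp only [ContinuousMap.add_apply, ContinuousMap.smul_apply, ContinuousMap.sum_apply,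
        ContinuousMap.sub_apply, neuronOn, dotOn, ContinuousMap.coe_mk, smul_eq_mul, ramp,
        zero_dotProduct, zero_add, smul_dotProduct]
      congr 1
      · simp
      · refine Finset.sum_congr rfl fun i _ => ?_
        congr 3 <;> ring
    · ring

/-- Stone–Weierstrass does not apply to `shallowNets` directly, as it is not closed under products.
The exponentials `exp (a · x)` are, so the algebra they generate is merely their span, and this lies
in the closure of `shallowNets`. -/
theorem closure_shallowNets_eq_top [CompactSpace S] : (shallowNets S).topologicalClosure = ⊤ := by
  have hsep : (Algebra.adjoin ℝ (expDotOn S : Set C(S, ℝ))).SeparatesPoints := by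
    classical
    intro x y hxy
    obtain ⟨i, hi⟩ : ∃ i, x.1 i ≠ y.1 i := by
      by_contra! hc
      exact hxy (Subtype.ext (funext hc))
    refine ⟨_, ⟨_, Algebra.subset_adjoin ⟨Pi.single i 1, rfl⟩, rfl⟩, ?_⟩
    simpa [dotOn] using hi
  have htop := ContinuousMap.subalgebra_topologicalClosure_eq_top_of_separatesPoints _ hsep
  have hle : Subalgebra.toSubmodule (Algebra.adjoin ℝ (expDotOn S : Set C(S, ℝ))) ≤
      (shallowNets S).topologicalClosure := by
    rw [Algebra.adjoin_eq_span, Submonoid.closure_eq, Submodule.span_le]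
    rintro _ ⟨a, rfl⟩
    exact ridge_mem_closure_shallowNets Real.exp Real.continuous_exp a
  rw [eq_top_iff]
  intro f _
  have hf : f ∈ (Algebra.adjoin ℝ (expDotOn S : Set C(S, ℝ))).topologicalClosure := by
    rw [htop]; trivial
  have hf' : f ∈ closure ((Algebra.adjoin ℝ (expDotOn S : Set C(S, ℝ))) : Set C(S, ℝ)) := hf
  exact closure_minimal hle (Submodule.isClosed_topologicalClosure _) hf'

/-- Universal approximation by networks with one hidden ReLU layer. -/
theorem exists_shallowNet_approx (hS : IsCompact S) (F : (κ → ℝ) → ℝ) (hF : ContinuousOn F S)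
    {ε : ℝ} (hε : 0 < ε) :
    ∃ (N : ℕ) (W : Fin N → κ → ℝ) (b v : Fin N → ℝ), ∀ x ∈ S,
      |∑ i, v i * max 0 (W i ⬝ᵥ x + b i) - F x| ≤ ε := by
  have : CompactSpace S := isCompact_iff_compactSpace.mp hS
  let f : C(S, ℝ) := ⟨S.domRestrict F, continuousOn_iff_continuous_domRestrict.mp hF⟩
  have hf : f ∈ closure (shallowNets S : Set C(S, ℝ)) := by
    rw [← Submodule.topologicalClosure_coe, closure_shallowNets_eq_top]
    trivial
  obtain ⟨g, hg, hfg⟩ := Metric.mem_closure_iff.mp hf ε hε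
  obtain ⟨c, rfl⟩ := Finsupp.mem_span_range_iff_exists_finsupp.mp hg
  let φ := c.support.equivFin.symm
  refine ⟨c.support.card, fun i => (φ i).1.1, fun i => (φ i).1.2, fun i => c (φ i), ?_⟩
  intro x hx
  have h1 : ∑ i, c (φ i) * max 0 ((φ i).1.1 ⬝ᵥ x + (φ i).1.2)
      = (c.sum fun p a => a • neuronOn S p) ⟨x, hx⟩ := by
    rw [φ.sum_comp (fun p : c.support => c p * max 0 (p.1.1 ⬝ᵥ x + p.1.2)), Finsupp.sum,
      ContinuousMap.sum_apply, ← Finset.sum_coe_sort c.support]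
    rfl
  rw [h1]
  have h2 := ContinuousMap.dist_apply_le_dist (f := f) (g := c.sum fun p a => a • neuronOn S p)
    ⟨x, hx⟩
  rw [Real.dist_eq, abs_sub_comm] at h2
  exact h2.trans hfg.le

end UniversalApproximation

/-! ### Feed-forward networks on selected coordinates -/

section FeedForward

variable {κ κ' : Type*} [Fintype κ] [Fintype κ']

/-- Universal approximation by vector-valued networks with one hidden ReLU layer. -/
theorem exists_shallowNet_approx_vector {S : Set (κ → ℝ)} (hS : IsCompact S)
    (F : (κ → ℝ) → κ' → ℝ) (hF : ContinuousOn F S) {ε : ℝ} (hε : 0 < ε) :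
    ∃ (N : ℕ) (W : Matrix (Fin N) κ ℝ) (b : Fin N → ℝ) (V : Matrix κ' (Fin N) ℝ), ∀ x ∈ S, ∀ j,
      |V.mulVec (fun i => max 0 (W.mulVec x i + b i)) j - F x j| ≤ ε := by
  classical
  have hcoord : ∀ j, ContinuousOn (fun x => F x j) S := continuousOn_pi.mp hF
  choose N W b v hv using fun j => exists_shallowNet_approx hS (fun x => F x j) (hcoord j) hε
  let φ := (Fintype.equivFin ((j : κ') × Fin (N j))).symm
  refine ⟨_, fun i => W (φ i).1 (φ i).2, fun i => b (φ i).1 (φ i).2,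
    fun j i => if (φ i).1 = j then v (φ i).1 (φ i).2 else 0, fun x hx j => ?_⟩
  convert hv j x hx using 3
  simp only [Matrix.mulVec, dotProduct]
  rw [φ.sum_comp (fun p : (j : κ') × Fin (N j) => (if p.1 = j then v p.1 p.2 else 0) *
    max 0 (∑ k, W p.1 p.2 k * x k + b p.1 p.2)), Fintype.sum_sigma,
    Finset.sum_eq_single j]
  · simp
  · intro j' _ hj'
    simp [hj']
  · simp

/-- A network with one hidden ReLU layer that reads the coordinates `r` and writes an approximation
of `F` to the coordinates `wr`, robustly in its input. -/
theorem exists_feedForward {D : ℕ} (r : κ → Fin D) (wr : κ' → Fin D)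
    (hwr : Function.Injective wr) (F : (κ → ℝ) → κ' → ℝ) (hF : Continuous F) (M : ℝ) {ε : ℝ}
    (hε : 0 < ε) :
    ∃ δ > 0, ∃ (N : ℕ) (W₁ : Matrix (Fin N) (Fin D) ℝ) (b₁ : Fin N → ℝ)
      (W₂ : Matrix (Fin D) (Fin N) ℝ),
      (∀ x i, i ∉ Set.range wr → W₂.mulVec (fun a => max 0 (W₁.mulVec x a + b₁ a)) i = 0) ∧
      ∀ (x : Fin D → ℝ) (z : κ → ℝ), (∀ k, |z k| ≤ M) → (∀ k, |x (r k) - z k| ≤ δ) →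
        ∀ j, |W₂.mulVec (fun a => max 0 (W₁.mulVec x a + b₁ a)) (wr j) - F z j| ≤ ε := by
  classical
  -- The cube is enlarged by `1`, so that inputs perturbed by at most `min δ 1` remain where the
  -- network approximates `F`.
  have hK : IsCompact (Set.univ.pi fun _ : κ => Set.Icc (-(M + 1)) (M + 1)) :=
    isCompact_univ_pi fun _ => isCompact_Icc
  obtain ⟨N, W, b, V, hV⟩ := exists_shallowNet_approx_vector hK F hF.continuousOn (half_pos hε)
  obtain ⟨δ, hδ, huc⟩ := Metric.uniformContinuousOn_iff_le.mp
    (hK.uniformContinuousOn_of_continuous hF.continuousOn) (ε / 2) (half_pos hε)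
  let P : Matrix κ (Fin D) ℝ := fun k i => if i = r k then 1 else 0
  let Q : Matrix (Fin D) κ' ℝ := fun i j => if wr j = i then 1 else 0
  have hP : ∀ x, P.mulVec x = fun k => x (r k) := by
    intro x
    ext k
    simp [P, Matrix.mulVec, dotProduct]
  refine ⟨min δ 1, by positivity, N, W * P, b, Q * V, ?_, ?_⟩
  · intro x i hi
    rw [← Matrix.mulVec_mulVec]
    refine Finset.sum_eq_zero fun j _ => ?_
    simp only [Q]
    rw [if_neg (fun h => hi ⟨j, h⟩), zero_mul]
  · intro x z hz hx j
    have hQ : ∀ y : κ' → ℝ, Q.mulVec y (wr j) = y j := by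
      intro y
      simp [Q, Matrix.mulVec, dotProduct, hwr.eq_iff]
    rw [← Matrix.mulVec_mulVec, hQ]
    simp only [← Matrix.mulVec_mulVec, hP]
    have hzK : z ∈ Set.univ.pi fun _ : κ => Set.Icc (-(M + 1)) (M + 1) := fun k _ => by
      have := abs_le.mp (hz k)
      constructor <;> linarith
    have hxK : (fun k => x (r k)) ∈ Set.univ.pi fun _ : κ => Set.Icc (-(M + 1)) (M + 1) :=
      fun k _ => by
        have h1 := abs_le.mp (hz k)
        have h2 := abs_le.mp ((hx k).trans (min_le_right _ _))
        constructor <;> dsimp only <;> linarith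
    have h1 := hV _ hxK j
    have h2 := huc _ hxK _ hzK
      ((dist_pi_le_iff hδ.le).2 fun k => (hx k).trans (min_le_left _ _))
    have h3 := (dist_le_pi_dist _ _ j).trans h2
    rw [Real.dist_eq] at h3
    exact (abs_sub_le _ _ _).trans ((add_le_add h1 h3).trans (by linarith))

end FeedForward

/-! ### Softmax at low temperature -/

section Softmax

variable {α : Type*} (A S : Finset α) (q : α → ℝ)

/-- The softmax weight at inverse temperature `β` converges to the uniform weight on the set of
maximizers. -/
theorem tendsto_softmax [DecidableEq α] (hSA : S ⊆ A) (hS : S.Nonempty) {c : ℝ}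
    (hc : ∀ s ∈ S, q s = c) (hlt : ∀ s ∈ A, s ∉ S → q s < c) {s : α} (hs : s ∈ A) :
    Filter.Tendsto (fun β : ℝ => Real.exp (β * q s) / ∑ r ∈ A, Real.exp (β * q r)) Filter.atTop
      (nhds (if s ∈ S then 1 / (S.card : ℝ) else 0)) := by
  -- After subtracting the maximal score `c`, the exponentials are `1` on `S` and tend to `0` off
  -- it.
  have hshift : ∀ β : ℝ, Real.exp (β * q s) / ∑ r ∈ A, Real.exp (β * q r) =
      Real.exp (β * (q s - c)) / ∑ r ∈ A, Real.exp (β * (q r - c)) := by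
    intro β
    simp only [mul_sub, Real.exp_sub, ← Finset.sum_div]
    rw [div_div_div_cancel_right₀ (Real.exp_ne_zero _)]
  have hlim : ∀ r ∈ A, Filter.Tendsto (fun β : ℝ => Real.exp (β * (q r - c))) Filter.atTop
      (nhds (if r ∈ S then 1 else 0)) := by
    intro r hr
    split_ifs with hrS
    · simp [hc r hrS]
    · exact Real.tendsto_exp_atBot.comp
        (Filter.tendsto_id.atTop_mul_const_of_neg (sub_neg.mpr (hlt r hr hrS)))
  have hsum := tendsto_finsetSum A hlim
  have hcard : (∑ r ∈ A, if r ∈ S then (1 : ℝ) else 0) = S.card := by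
    rw [Finset.sum_ite_mem, Finset.inter_eq_right.mpr hSA]
    simp
  rw [hcard] at hsum
  simp only [hshift]
  have := (hlim s hs).div hsum (by exact_mod_cast hS.card_pos.ne')
  convert this using 2
  · rfl
  · split_ifs <;> simp

/-- The weights do not involve `v`, so their convergence is uniform over all values bounded by `M`;
a single `β` therefore serves every prompt. -/
theorem eventually_softmax_average (hSA : S ⊆ A) (hS : S.Nonempty) {c : ℝ}
    (hc : ∀ s ∈ S, q s = c) (hlt : ∀ s ∈ A, s ∉ S → q s < c) {M δ : ℝ} (hM : 0 ≤ M)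
    (hδ : 0 < δ) :
    ∀ᶠ β : ℝ in Filter.atTop, ∀ v : α → ℝ, (∀ s ∈ A, |v s| ≤ M) →
      |∑ s ∈ A, Real.exp (β * q s) / (∑ r ∈ A, Real.exp (β * q r)) * v s
        - (∑ s ∈ S, v s) / S.card| ≤ δ := by
  classical
  have hA : (0 : ℝ) < A.card := by exact_mod_cast (hS.mono hSA).card_pos
  set η := δ / (A.card * (M + 1)) with hη
  have hη0 : 0 < η := by positivity
  have hev : ∀ᶠ β : ℝ in Filter.atTop, ∀ s ∈ A,
      |Real.exp (β * q s) / (∑ r ∈ A, Real.exp (β * q r))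
        - (if s ∈ S then 1 / (S.card : ℝ) else 0)| ≤ η := by
    rw [Filter.eventually_all_finset]
    intro s hs
    have := Metric.tendsto_nhds.mp (tendsto_softmax A S q hSA hS hc hlt hs) η hη0
    exact this.mono fun β h => h.le
  filter_upwards [hev] with β hβ v hv
  have hrw : (∑ s ∈ S, v s) / S.card = ∑ s ∈ A, (if s ∈ S then 1 / (S.card : ℝ) else 0) * v s := by
    simp only [ite_mul, zero_mul]
    rw [Finset.sum_ite_mem, Finset.inter_eq_right.mpr hSA, Finset.sum_div]
    exact Finset.sum_congr rfl fun s _ => by ring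
  rw [hrw, ← Finset.sum_sub_distrib]
  refine (Finset.abs_sum_le_sum_abs _ _).trans ?_
  have hterm : ∀ s ∈ A, |Real.exp (β * q s) / (∑ r ∈ A, Real.exp (β * q r)) * v s
      - (if s ∈ S then 1 / (S.card : ℝ) else 0) * v s| ≤ η * (M + 1) := by
    intro s hs
    rw [← sub_mul, abs_mul]
    exact mul_le_mul (hβ s hs) ((hv s hs).trans (by linarith)) (abs_nonneg _) hη0.le
  refine (Finset.sum_le_sum hterm).trans ?_
  rw [Finset.sum_const, nsmul_eq_mul, hη]
  apply le_of_eq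
  field_simp

/-- Softmax weights form a convex combination. This controls the attention output at positions where
nothing meaningful is selected. -/
theorem abs_softmax_average_le (hA : A.Nonempty) {M : ℝ} (v : α → ℝ) (hv : ∀ s ∈ A, |v s| ≤ M) :
    |∑ s ∈ A, Real.exp (q s) / (∑ r ∈ A, Real.exp (q r)) * v s| ≤ M := by
  have hpos : 0 < ∑ r ∈ A, Real.exp (q r) := Finset.sum_pos (fun _ _ => Real.exp_pos _) hA
  refine (Finset.abs_sum_le_sum_abs _ _).trans ?_
  calc ∑ s ∈ A, |Real.exp (q s) / (∑ r ∈ A, Real.exp (q r)) * v s|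
      ≤ ∑ s ∈ A, Real.exp (q s) / (∑ r ∈ A, Real.exp (q r)) * M := by
        refine Finset.sum_le_sum fun s hs => ?_
        rw [abs_mul, abs_of_nonneg (by positivity)]
        exact mul_le_mul_of_nonneg_left (hv s hs) (by positivity)
    _ = M := by
        rw [← Finset.sum_mul, ← Finset.sum_div, div_self hpos.ne', one_mul]

end Softmax

/-! ### Binary position codes -/

section SignBits

/-- The `a`-th binary digit of `u`, written as `±1`. -/
def signBit (u a : ℕ) : ℝ := if u.testBit a then 1 else -1

theorem signBit_mul_self (u a : ℕ) : signBit u a * signBit u a = 1 := by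
  unfold signBit
  split_ifs <;> norm_num

theorem sum_signBit_mul_self (b u : ℕ) :
    ∑ a : Fin b, signBit u a * signBit u a = b := by
  simp [signBit_mul_self]

/-- Distinct numbers below `2 ^ b` differ in one of the first `b` digits, and that digit contributes
`-1` instead of `1`. -/
theorem sum_signBit_mul_lt {b u v : ℕ} (hu : u < 2 ^ b) (hv : v < 2 ^ b) (huv : u ≠ v) :
    ∑ a : Fin b, signBit u a * signBit v a < b := by
  obtain ⟨a, ha⟩ : ∃ a, u.testBit a ≠ v.testBit a := by
    by_contra! h
    exact huv (Nat.eq_of_testBit_eq h)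
  have hab : a < b := by
    by_contra! hba
    have hpow := Nat.pow_le_pow_right (n := 2) (by norm_num) hba
    rw [Nat.testBit_lt_two_pow (hu.trans_le hpow), Nat.testBit_lt_two_pow (hv.trans_le hpow)] at ha
    exact ha rfl
  have hcard : (b : ℝ) = ∑ _a : Fin b, (1 : ℝ) := by simp
  rw [hcard]
  refine Finset.sum_lt_sum (fun i _ => ?_) ⟨⟨a, hab⟩, Finset.mem_univ _, ?_⟩
  · unfold signBit
    split_ifs <;> norm_num
  · unfold signBit
    dsimp only
    split_ifs with h1 h2 h2 <;> first | (exfalso; simp_all; done) | norm_num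

end SignBits

/-! ### Clamping and soft indicators -/

/-- The clamping of a vector to the cube `[-R, R]^d`. -/
def clampCube {d : ℕ} (R : ℝ) (x : Fin d → ℝ) : Fin d → ℝ := fun c => max (-R) (min R (x c))

theorem continuous_clampCube {d : ℕ} (R : ℝ) : Continuous (clampCube (d := d) R) := by
  unfold clampCube
  fun_prop

theorem clampCube_mem_cube {d : ℕ} {R : ℝ} (hR : 0 ≤ R) (x : Fin d → ℝ) :
    clampCube R x ∈ cube d R := fun c =>
  abs_le.mpr ⟨le_max_left _ _, max_le (by linarith) (min_le_left _ _)⟩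

theorem clampCube_eq_self {d : ℕ} {R : ℝ} {x : Fin d → ℝ} (hx : x ∈ cube d R) :
    clampCube R x = x := by
  ext c
  have := abs_le.mp (hx c)
  unfold clampCube
  rw [min_eq_right this.2, max_eq_right this.1]

theorem continuous_softIndicator (τ : ℝ) : Continuous (softIndicator τ) := by
  unfold softIndicator
  fun_prop

theorem softIndicator_nonneg (τ z : ℝ) : 0 ≤ softIndicator τ z := le_max_left _ _

theorem softIndicator_le_one {τ z : ℝ} (hτ : 0 ≤ τ) (hz : 0 ≤ z) : softIndicator τ z ≤ 1 :=
  max_le zero_le_one (by nlinarith [mul_nonneg hτ hz])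

theorem continuous_softmaxWeight : Continuous softmaxWeight := by
  unfold softmaxWeight
  exact continuous_const.div (by fun_prop) fun p => by positivity

theorem VecTask.softProportion_mem_Icc {d m ℓ : ℕ} {τ : ℝ} (hτ : 0 ≤ τ) (hm : 1 ≤ m)
    (g : VecTask d ℓ) (P : Prompt d m ℓ) : g.softProportion τ P ∈ Set.Icc 0 1 := by
  have hm' : (0 : ℝ) < m := by exact_mod_cast hm
  refine ⟨div_nonneg (Finset.sum_nonneg fun j _ => softIndicator_nonneg _ _) hm'.le, ?_⟩
  refine (div_le_one hm').2 ?_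
  calc ∑ j, softIndicator τ (g.discrepancy P j) ≤ ∑ _j : Fin m, (1 : ℝ) :=
        Finset.sum_le_sum fun j _ => softIndicator_le_one hτ
          (Finset.sum_nonneg fun c _ => abs_nonneg _)
    _ = m := by simp

/-- If the labels decide the task up to `1 / τ`, the soft proportion is the true proportion. -/
theorem VecTask.softProportion_eq_proportion {d m ℓ : ℕ} {τ : ℝ} (hτ : 0 < τ)
    (g : VecTask d ℓ) (P : Prompt d m ℓ)
    (h : ∀ j, P.label j = g.answer (P.input j) ∨ 1 / τ ≤ g.discrepancy P j) :
    g.softProportion τ P = g.proportion P := by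
  classical
  unfold VecTask.softProportion VecTask.proportion
  congr 1
  have hind : ∀ j, softIndicator τ (g.discrepancy P j)
      = if P.label j = g.answer (P.input j) then 1 else 0 := by
    intro j
    split_ifs with hj
    · simp [softIndicator, VecTask.discrepancy, hj]
    · have hd := (h j).resolve_left hj
      rw [div_le_iff₀ hτ] at hd
      exact max_eq_left (by linarith)
  rw [Finset.sum_congr rfl fun j _ => hind j, Finset.sum_boole, Set.ncard_eq_toFinset_card']
  congr 2
  ext j
  simp

/-! ### Positions in the prompt and sharp attention to them -/

section Positions

variable {d m ℓ : ℕ}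

theorem block_mod {j i : ℕ} (hi : i < ℓ + 2) : (j * (ℓ + 2) + i) % (ℓ + 2) = i := by
  rw [Nat.mul_add_mod', Nat.mod_eq_of_lt hi]

theorem block_div {j i : ℕ} (hi : i < ℓ + 2) : (j * (ℓ + 2) + i) / (ℓ + 2) = j := by
  rw [Nat.add_comm, Nat.add_mul_div_right _ _ (by omega), Nat.div_eq_of_lt hi, Nat.zero_add]

/-- The position of the label of example `j`. -/
def labelPosition (j : Fin m) : Fin (promptLength m ℓ) :=
  ⟨j * (ℓ + 2) + (ℓ + 1), by
    have : (j + 1) * (ℓ + 2) ≤ m * (ℓ + 2) := Nat.mul_le_mul_right _ j.2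
    unfold promptLength
    nlinarith⟩

theorem labelPosition_injective : Function.Injective (labelPosition (m := m) (ℓ := ℓ)) := by
  intro i j h
  have h' : (i : ℕ) * (ℓ + 2) + (ℓ + 1) = j * (ℓ + 2) + (ℓ + 1) := congrArg Fin.val h
  exact Fin.ext (Nat.eq_of_mul_eq_mul_right (by omega : 0 < ℓ + 2) (by omega))

/-- The query has no label: the sequence ends just before the place where its label would stand. -/
theorem div_lt_of_mod_eq (t : Fin (promptLength m ℓ)) (ht : t.val % (ℓ + 2) = ℓ + 1) :
    t.val / (ℓ + 2) < m := by
  by_contra! hge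
  have h1 := Nat.div_add_mod t.val (ℓ + 2)
  have h2 : m * (ℓ + 2) ≤ (ℓ + 2) * (t.val / (ℓ + 2)) := by
    rw [Nat.mul_comm]; exact Nat.mul_le_mul_left _ hge
  have h3 : t.val < m * (ℓ + 2) + (ℓ + 1) := t.2
  omega

theorem div_le_count (t : Fin (promptLength m ℓ)) : t.val / (ℓ + 2) ≤ m := by
  have h3 : t.val < m * (ℓ + 2) + (ℓ + 1) := t.2
  have : t.val < (m + 1) * (ℓ + 2) := by rw [Nat.succ_mul]; omega
  exact Nat.lt_succ_iff.mp (Nat.div_lt_of_lt_mul (by rwa [Nat.mul_comm]))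

/-- The position of place `i` in the block of position `t`, if `t` is the equals sign or the label
of its block. -/
def sourcePosition (i : Fin ℓ) (t : Fin (promptLength m ℓ)) : Fin (promptLength m ℓ) :=
  if h : ℓ ≤ t.val % (ℓ + 2) then
    ⟨t.val / (ℓ + 2) * (ℓ + 2) + i, by
      have h1 := Nat.div_add_mod' t.val (ℓ + 2)
      have := t.2
      have := i.2
      omega⟩
  else t

theorem sourcePosition_val (i : Fin ℓ) {t : Fin (promptLength m ℓ)} (h : ℓ ≤ t.val % (ℓ + 2)) :
    (sourcePosition i t).val = t.val / (ℓ + 2) * (ℓ + 2) + i := by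
  rw [sourcePosition, dif_pos h]

theorem sourcePosition_le (i : Fin ℓ) {t : Fin (promptLength m ℓ)} (h : ℓ ≤ t.val % (ℓ + 2)) :
    sourcePosition i t ≤ t := by
  rw [Fin.le_def, sourcePosition_val i h]
  have h1 := Nat.div_add_mod' t.val (ℓ + 2)
  have := i.2
  omega

theorem mem_attended_of_le {L : ℕ} (causal : Bool) {s t : Fin L} (h : s ≤ t) :
    s ∈ attended causal t := by
  unfold attended
  split_ifs
  · exact Finset.mem_Iic.mpr h
  · exact Finset.mem_univ _

/-- The overlap of the position codes by which position `t` looks for place `i` of its block. -/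
noncomputable def selectScore (b ℓ i t s : ℕ) : ℝ :=
  (∑ a : Fin b, signBit (s / (ℓ + 2)) a * signBit (t / (ℓ + 2)) a) +
    ∑ a : Fin b, signBit (s % (ℓ + 2)) a * signBit i a

/-- The flag of the label positions. -/
noncomputable def labelFlag (ℓ s : ℕ) : ℝ := if s % (ℓ + 2) = ℓ + 1 then 1 else 0

/-- Sharp attention by position codes selects the token at place `i` of the current block. -/
theorem eventually_select {ι : Type*} [Finite ι] {b : ℕ} (hm : m < 2 ^ b) (hℓ : ℓ + 2 ≤ 2 ^ b)
    (causal : Bool) (place : ι → Fin ℓ) {M δ : ℝ} (hM : 0 ≤ M) (hδ : 0 < δ) :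
    ∀ᶠ β : ℝ in Filter.atTop, ∀ (k : ι) (t : Fin (promptLength m ℓ)), ℓ ≤ t.val % (ℓ + 2) →
      ∀ v : Fin (promptLength m ℓ) → ℝ, (∀ s, |v s| ≤ M) →
      |∑ s ∈ attended causal t, Real.exp (β * selectScore b ℓ (place k) t s) /
        (∑ r ∈ attended causal t, Real.exp (β * selectScore b ℓ (place k) t r)) * v s
          - v (sourcePosition (place k) t)| ≤ δ := by
  rw [Filter.eventually_all]
  intro k
  rw [Filter.eventually_all]
  intro t
  by_cases ht : ℓ ≤ t.val % (ℓ + 2)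
  swap
  · exact Filter.Eventually.of_forall fun _ h => absurd h ht
  set i := place k
  have hi : i.val < ℓ + 2 := i.2.trans (by omega)
  have hbound : ∀ s : Fin (promptLength m ℓ), s.val / (ℓ + 2) < 2 ^ b ∧ s.val % (ℓ + 2) < 2 ^ b :=
    fun s => ⟨(div_le_count s).trans_lt hm, (Nat.mod_lt _ (by omega)).trans_le hℓ⟩
  have hsrc := sourcePosition_val i ht
  have hev := eventually_softmax_average (attended causal t) {sourcePosition i t}
    (fun s : Fin (promptLength m ℓ) => selectScore b ℓ i t s)
    (Finset.singleton_subset_iff.mpr (mem_attended_of_le causal (sourcePosition_le i ht)))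
    -- At the wanted position all `b` block digits and all `b` place digits agree.
    (Finset.singleton_nonempty _) (c := b + b) (by
      intro s hs
      rw [Finset.mem_singleton.mp hs, hsrc, selectScore, block_div hi, block_mod hi,
        sum_signBit_mul_self, sum_signBit_mul_self]) (by
      intro s _ hs
      have hle : ∀ u v : ℕ, u < 2 ^ b → v < 2 ^ b → ∑ a : Fin b, signBit u a * signBit v a ≤ b := by
        intro u v hu hv
        by_cases huv : u = v
        · rw [huv, sum_signBit_mul_self]
        · exact (sum_signBit_mul_lt hu hv huv).le
      have h1 := hle _ _ (hbound s).1 (hbound t).1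
      have h2 := hle _ _ (hbound s).2 (hi.trans_le hℓ)
      unfold selectScore
      -- Any other position differs in block or in place, so one of the two sums falls strictly
      -- below `b` and the other cannot make up for it.
      by_cases hdiv : s.val / (ℓ + 2) = t.val / (ℓ + 2)
      · by_cases hmod : s.val % (ℓ + 2) = i
        · refine absurd (Finset.mem_singleton.mpr (Fin.ext ?_)) hs
          rw [hsrc, ← hdiv, ← hmod, Nat.div_add_mod']
        · linarith [sum_signBit_mul_lt (hbound s).2 (hi.trans_le hℓ) hmod]
      · linarith [sum_signBit_mul_lt (hbound s).1 (hbound t).1 hdiv]) hM hδ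
  filter_upwards [hev] with β hβ _ v hv
  simpa using hβ v fun s _ => hv s

/-- Sharp attention to the label flag averages over the label positions. -/
theorem eventually_average (hm : 1 ≤ m) (causal : Bool) {M δ : ℝ} (hM : 0 ≤ M) (hδ : 0 < δ) :
    ∀ᶠ β : ℝ in Filter.atTop, ∀ v : Fin (promptLength m ℓ) → ℝ, (∀ s, |v s| ≤ M) →
      |∑ s ∈ attended causal (lastPosition m ℓ), Real.exp (β * labelFlag ℓ s) /
        (∑ r ∈ attended causal (lastPosition m ℓ), Real.exp (β * labelFlag ℓ r)) * v s
          - (∑ j : Fin m, v (labelPosition j)) / m| ≤ δ := by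
  classical
  have hev := eventually_softmax_average (attended causal (lastPosition m ℓ))
    (Finset.univ.image (labelPosition (m := m) (ℓ := ℓ)))
    (fun s : Fin (promptLength m ℓ) => labelFlag ℓ s) (by
      intro s hs
      obtain ⟨j, -, rfl⟩ := Finset.mem_image.mp hs
      apply mem_attended_of_le
      rw [Fin.le_def]
      have : (j + 1) * (ℓ + 2) ≤ m * (ℓ + 2) := Nat.mul_le_mul_right _ j.2
      simp only [labelPosition, lastPosition]
      nlinarith)
    ⟨labelPosition ⟨0, hm⟩, Finset.mem_image_of_mem _ (Finset.mem_univ _)⟩ (c := 1) (by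
      intro s hs
      obtain ⟨j, -, rfl⟩ := Finset.mem_image.mp hs
      simp [labelFlag, labelPosition]) (by
      intro s _ hs
      rw [labelFlag, if_neg]
      · exact one_pos
      · intro hmod
        refine hs (Finset.mem_image.mpr ⟨⟨s.val / (ℓ + 2), div_lt_of_mod_eq s hmod⟩,
          Finset.mem_univ _, Fin.ext ?_⟩)
        simp only [labelPosition]
        rw [← hmod, Nat.div_add_mod']) hM hδ
  filter_upwards [hev] with β hβ v hv
  have := hβ v fun s _ => hv s
  rwa [Finset.sum_image labelPosition_injective.injOn,
    Finset.card_image_of_injective _ labelPosition_injective, Finset.card_univ,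
    Fintype.card_fin] at this

theorem tokens_sourcePosition_labelPosition (e : Fin d → ℝ) (P : Prompt d m ℓ) (i : Fin ℓ)
    (j : Fin m) (c : Fin d) :
    P.tokens e (sourcePosition i (labelPosition j)) (Sum.inl c) = P.input j i c := by
  have hv : (labelPosition (ℓ := ℓ) j).val = j * (ℓ + 2) + (ℓ + 1) := rfl
  have hs := sourcePosition_val (m := m) i (t := labelPosition j)
    (by rw [hv, block_mod (by omega)]; omega)
  have hi : i.val < ℓ + 2 := i.2.trans (by omega)
  rw [hv, block_div (by omega)] at hs
  unfold Prompt.tokens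
  simp [hs, block_mod hi, block_div hi, vectorToken]

theorem tokens_sourcePosition_lastPosition (e : Fin d → ℝ) (P : Prompt d m ℓ) (i : Fin ℓ)
    (c : Fin d) :
    P.tokens e (sourcePosition i (lastPosition m ℓ)) (Sum.inl c) = P.query i c := by
  have hv : (lastPosition m ℓ).val = m * (ℓ + 2) + ℓ := rfl
  have hs := sourcePosition_val (m := m) i (t := lastPosition m ℓ)
    (by rw [hv, block_mod (by omega)])
  have hi : i.val < ℓ + 2 := i.2.trans (by omega)
  rw [hv, block_div (by omega)] at hs
  unfold Prompt.tokens
  simp [hs, block_mod hi, block_div hi, vectorToken]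

theorem tokens_labelPosition (e : Fin d → ℝ) (P : Prompt d m ℓ) (j : Fin m) (c : Fin d) :
    P.tokens e (labelPosition j) (Sum.inl c) = P.label j c := by
  have hv : (labelPosition (ℓ := ℓ) j).val = j * (ℓ + 2) + (ℓ + 1) := rfl
  unfold Prompt.tokens
  simp [hv, block_div, vectorToken]

theorem Prompt.BoundedBy.abs_tokens_le {P : Prompt d m ℓ} {R B : ℝ} (hP : P.BoundedBy R B)
    (hR : 0 ≤ R) (hB : 0 ≤ B) (e : Fin d → ℝ) (t : Fin (promptLength m ℓ)) (c : Fin d) :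
    |P.tokens e t (Sum.inl c)| ≤ R + B + ∑ c, |e c| := by
  have he : ∀ c, |e c| ≤ ∑ c, |e c| := fun c =>
    Finset.single_le_sum (f := fun c => |e c|) (fun _ _ => abs_nonneg _) (Finset.mem_univ c)
  have he0 : 0 ≤ ∑ c, |e c| := Finset.sum_nonneg fun _ _ => abs_nonneg _
  unfold Prompt.tokens
  split_ifs
  · exact (hP.1 _ _ c).trans (by linarith)
  · exact (hP.2.1 _ c).trans (by linarith)
  · exact (he c).trans (by linarith)
  · exact (hP.2.2 _ c).trans (by linarith)
  · simp; linarith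

end Positions

/-! ### Attention heads given by rows of functionals -/

section RowMatrix

variable {ι : Type*} [Fintype ι] [DecidableEq ι] {D : ℕ}

/-- The square matrix whose rows, indexed through `e`, are the given linear functionals. -/
noncomputable def rowMatrix (e : ι ≃ Fin D) (φ : ι → (ι → ℝ) →ₗ[ℝ] ℝ) :
    Matrix (Fin D) (Fin D) ℝ :=
  (LinearMap.toMatrix' (LinearMap.pi φ)).submatrix e.symm e.symm

theorem rowMatrix_mulVec (e : ι ≃ Fin D) (φ : ι → (ι → ℝ) →ₗ[ℝ] ℝ) (x : Fin D → ℝ) (i : ι) :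
    (rowMatrix e φ).mulVec x (e i) = φ i (fun j => x (e j)) := by
  unfold rowMatrix
  rw [Matrix.submatrix_mulVec_equiv]
  simp only [Equiv.symm_symm, Function.comp_apply, Equiv.symm_apply_apply,
    LinearMap.toMatrix'_mulVec, LinearMap.pi_apply]
  rfl

/-- The attention head whose key, query and value matrices have the given rows. -/
noncomputable def rowHead (e : ι ≃ Fin D) (key query value : ι → (ι → ℝ) →ₗ[ℝ] ℝ) :
    AttentionHead D where
  WK := rowMatrix e key
  WQ := rowMatrix e query
  WV := rowMatrix e value

theorem rowHead_logit {L : ℕ} (e : ι ≃ Fin D) (key query value : ι → (ι → ℝ) →ₗ[ℝ] ℝ)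
    (X : Fin L → Fin D → ℝ) (t s : Fin L) :
    (rowHead e key query value).logit X t s
      = ∑ i, key i (fun j => X s (e j)) * query i (fun j => X t (e j)) := by
  unfold AttentionHead.logit dotProduct
  rw [← e.sum_comp]
  simp only [rowHead, rowMatrix_mulVec]

theorem rowHead_out {L : ℕ} (causal : Bool) (e : ι ≃ Fin D)
    (key query value : ι → (ι → ℝ) →ₗ[ℝ] ℝ) (X : Fin L → Fin D → ℝ) (t : Fin L) (i : ι) :
    (rowHead e key query value).out causal X t (e i)
      = ∑ s ∈ attended causal t, (rowHead e key query value).weight causal X t s *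
          value i (fun j => X s (e j)) := by
  unfold AttentionHead.out
  rw [Finset.sum_apply]
  refine Finset.sum_congr rfl fun s _ => ?_
  rw [Pi.smul_apply, smul_eq_mul]
  simp only [rowHead, rowMatrix_mulVec]

end RowMatrix

/-! ### Coordinates, selecting heads and averaging heads -/

/-- The coordinates of the embedding space: the token; the digits of the block number and of the
place, a constant, and the flag of the labels; for each task the selected input, the soft
indicator, the average of the soft indicators, and the weighted prediction; the superposition. -/
abbrev Coord (d b K : ℕ) : Type :=
  Fin d ⊕ (Fin b ⊕ Fin b ⊕ Unit ⊕ Unit) ⊕ (Fin K × Fin d) ⊕ Fin K ⊕ Fin K ⊕ (Fin K × Fin d) ⊕ Fin d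

namespace Coord

variable {d b K : ℕ}

abbrev token (c : Fin d) : Coord d b K := .inl c
abbrev blockDigit (a : Fin b) : Coord d b K := .inr (.inl (.inl a))
abbrev placeDigit (a : Fin b) : Coord d b K := .inr (.inl (.inr (.inl a)))
abbrev unit : Coord d b K := .inr (.inl (.inr (.inr (.inl ()))))
abbrev flag : Coord d b K := .inr (.inl (.inr (.inr (.inr ()))))
abbrev selected (p : Fin K × Fin d) : Coord d b K := .inr (.inr (.inl p))
abbrev indicator (k : Fin K) : Coord d b K := .inr (.inr (.inr (.inl k)))
abbrev identifier (k : Fin K) : Coord d b K := .inr (.inr (.inr (.inr (.inl k))))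
abbrev prediction (p : Fin K × Fin d) : Coord d b K := .inr (.inr (.inr (.inr (.inr (.inl p)))))
abbrev combined (c : Fin d) : Coord d b K := .inr (.inr (.inr (.inr (.inr (.inr c)))))

end Coord

section Heads

variable {d b K : ℕ}

/-- The functional that reads a coordinate. -/
abbrev readCoord (i : Coord d b K) : (Coord d b K → ℝ) →ₗ[ℝ] ℝ := LinearMap.proj i

def selectKey : Coord d b K → (Coord d b K → ℝ) →ₗ[ℝ] ℝ
  | .inr (.inl (.inl a)) => readCoord (.blockDigit a)
  | .inr (.inl (.inr (.inl a))) => readCoord (.placeDigit a)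
  | _ => 0

/-- The block digits are those of the querying position itself, while the place digits are fixed.
Heads have no bias, so fixed digits must be read off the constant coordinate. -/
noncomputable def selectQuery (β : ℝ) (i : ℕ) : Coord d b K → (Coord d b K → ℝ) →ₗ[ℝ] ℝ
  | .inr (.inl (.inl a)) => β • readCoord (.blockDigit a)
  | .inr (.inl (.inr (.inl a))) => (β * signBit i a) • readCoord .unit
  | _ => 0

def selectValue (k : Fin K) : Coord d b K → (Coord d b K → ℝ) →ₗ[ℝ] ℝ
  | .inr (.inr (.inl p)) => if p.1 = k then readCoord (.token p.2) else 0
  | _ => 0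

def averageKey : Coord d b K → (Coord d b K → ℝ) →ₗ[ℝ] ℝ
  | .inr (.inl (.inr (.inr (.inr _)))) => readCoord .flag
  | _ => 0

noncomputable def averageQuery (β : ℝ) : Coord d b K → (Coord d b K → ℝ) →ₗ[ℝ] ℝ
  | .inr (.inl (.inr (.inr (.inr _)))) => β • readCoord .unit
  | _ => 0

def averageValue (k : Fin K) : Coord d b K → (Coord d b K → ℝ) →ₗ[ℝ] ℝ
  | .inr (.inr (.inr (.inr (.inl k')))) => if k' = k then readCoord (.indicator k) else 0
  | _ => 0

variable {D : ℕ} (E : Coord d b K ≃ Fin D)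

/-- The head that copies the token at place `i` of the current block into the stream of task `k`. -/
noncomputable def selectHead (β : ℝ) (i : ℕ) (k : Fin K) : AttentionHead D :=
  rowHead E selectKey (selectQuery β i) (selectValue k)

/-- The head that averages the indicators of task `k` over the label positions. -/
noncomputable def averageHead (β : ℝ) (k : Fin K) : AttentionHead D :=
  rowHead E averageKey (averageQuery β) (averageValue k)

variable {m ℓ : ℕ}

/-- The positional encodings. -/
noncomputable def positionCode (ℓ t : ℕ) : Coord d b K → ℝ
  | .inr (.inl (.inl a)) => signBit (t / (ℓ + 2)) a
  | .inr (.inl (.inr (.inl a))) => signBit (t % (ℓ + 2)) a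
  | .inr (.inl (.inr (.inr (.inl _)))) => 1
  | .inr (.inl (.inr (.inr (.inr _)))) => labelFlag ℓ t
  | _ => 0

theorem positionCode_mem (t : ℕ) (i : Coord d b K) :
    positionCode ℓ t i = -1 ∨ positionCode ℓ t i = 0 ∨ positionCode ℓ t i = 1 := by
  rcases i with i | (i | i | i | i) | i | i | i | i | i <;>
    simp only [positionCode, signBit, labelFlag] <;> (try split_ifs) <;> simp

/-- The columns `X` carry the positional encodings. -/
def CarriesPositions (X : Fin (promptLength m ℓ) → Fin D → ℝ) : Prop :=
  ∀ t (i : Fin b ⊕ Fin b ⊕ Unit ⊕ Unit), X t (E (.inr (.inl i))) =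
    positionCode (d := d) (K := K) ℓ t (.inr (.inl i))

/-- The logits involve positional coordinates only, so the attention pattern is independent of the
contents of the prompt. -/
theorem selectHead_weight (causal : Bool) (β : ℝ) (i : ℕ) (k : Fin K)
    {X : Fin (promptLength m ℓ) → Fin D → ℝ} (hX : CarriesPositions E X)
    (t s : Fin (promptLength m ℓ)) :
    (selectHead E β i k).weight causal X t s = Real.exp (β * selectScore b ℓ i t s) /
      ∑ r ∈ attended causal t, Real.exp (β * selectScore b ℓ i t r) := by
  have hlogit : ∀ s, (selectHead E β i k).logit X t s = β * selectScore b ℓ i t s := by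
    intro s
    unfold selectHead
    rw [rowHead_logit]
    simp only [Fintype.sum_sum_type, selectKey, selectQuery, LinearMap.zero_apply, mul_zero,
      Finset.sum_const_zero, add_zero, zero_add, LinearMap.smul_apply, LinearMap.proj_apply,
      smul_eq_mul, hX _ _, positionCode, selectScore, mul_add, Finset.mul_sum]
    congr 1 <;> refine Finset.sum_congr rfl fun a _ => ?_ <;> ring
  unfold AttentionHead.weight
  simp only [hlogit]

theorem averageHead_weight (causal : Bool) (β : ℝ) (k : Fin K)
    {X : Fin (promptLength m ℓ) → Fin D → ℝ} (hX : CarriesPositions E X)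
    (t s : Fin (promptLength m ℓ)) :
    (averageHead E β k).weight causal X t s = Real.exp (β * labelFlag ℓ s) /
      ∑ r ∈ attended causal t, Real.exp (β * labelFlag ℓ r) := by
  have hlogit : ∀ s, (averageHead E β k).logit X t s = β * labelFlag ℓ s := by
    intro s
    unfold averageHead
    rw [rowHead_logit]
    simp only [Fintype.sum_sum_type, averageKey, averageQuery, LinearMap.zero_apply, mul_zero,
      Finset.sum_const_zero, add_zero, zero_add, LinearMap.smul_apply, LinearMap.proj_apply,
      smul_eq_mul, hX _ _, positionCode, Finset.univ_unique, Finset.sum_singleton, mul_one]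
    ring
  unfold AttentionHead.weight
  simp only [hlogit]

theorem attention_apply {L : ℕ} (causal : Bool) (lay : TransformerLayer D K)
    (X : Fin L → Fin D → ℝ) (t : Fin L) (i : Fin D) :
    lay.attention causal X t i = X t i + ∑ k, (lay.head k).out causal X t i := by
  simp [TransformerLayer.attention]

theorem selectHead_out_selected (causal : Bool) (β : ℝ) (i : ℕ) (k : Fin K)
    {X : Fin (promptLength m ℓ) → Fin D → ℝ} (hX : CarriesPositions E X)
    (t : Fin (promptLength m ℓ)) (p : Fin K × Fin d) :
    (selectHead E β i k).out causal X t (E (.selected p)) = if p.1 = k then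
      ∑ s ∈ attended causal t, Real.exp (β * selectScore b ℓ i t s) /
        (∑ r ∈ attended causal t, Real.exp (β * selectScore b ℓ i t r)) * X s (E (.token p.2))
      else 0 := by
  have hw := selectHead_weight E causal β i k hX t
  unfold selectHead at hw ⊢
  rw [rowHead_out]
  simp only [hw, selectValue]
  split_ifs <;> simp

theorem averageHead_out_identifier (causal : Bool) (β : ℝ) (k : Fin K)
    {X : Fin (promptLength m ℓ) → Fin D → ℝ} (hX : CarriesPositions E X)
    (t : Fin (promptLength m ℓ)) (k' : Fin K) :
    (averageHead E β k).out causal X t (E (.identifier k')) = if k' = k then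
      ∑ s ∈ attended causal t, Real.exp (β * labelFlag ℓ s) /
        (∑ r ∈ attended causal t, Real.exp (β * labelFlag ℓ r)) * X s (E (.indicator k))
      else 0 := by
  have hw := averageHead_weight E causal β k hX t
  unfold averageHead at hw ⊢
  rw [rowHead_out]
  simp only [hw, averageValue]
  split_ifs <;> simp

theorem selectHead_out_of_value_eq_zero {L : ℕ} (causal : Bool) (β : ℝ) (i : ℕ) (k : Fin K)
    (X : Fin L → Fin D → ℝ) (t : Fin L) (j : Coord d b K)
    (hj : selectValue k j = 0) :
    (selectHead E β i k).out causal X t (E j) = 0 := by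
  unfold selectHead
  rw [rowHead_out]
  simp [hj]

theorem averageHead_out_of_value_eq_zero {L : ℕ} (causal : Bool) (β : ℝ) (k : Fin K)
    (X : Fin L → Fin D → ℝ) (t : Fin L) (j : Coord d b K)
    (hj : averageValue k j = 0) :
    (averageHead E β k).out causal X t (E j) = 0 := by
  unfold averageHead
  rw [rowHead_out]
  simp [hj]

end Heads

/-! ### The embedding dimension -/

section Dimension

theorem card_coord (d b K : ℕ) :
    Fintype.card (Coord d b K) = 2 * d + 2 * b + 2 + 2 * K * d + 2 * K := by
  simp only [Fintype.card_sum, Fintype.card_prod, Fintype.card_fin, Fintype.card_unit]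
  ring

theorem card_coord_le {d K N : ℕ} (hK : 1 ≤ K) (hN : 3 ≤ N) :
    (Fintype.card (Coord d (Nat.log 2 N + 1) K) : ℝ) ≤ 10 * K * (d + Real.log N) := by
  rw [card_coord]
  have hK' : (1 : ℝ) ≤ K := by exact_mod_cast hK
  have hN' : (3 : ℝ) ≤ N := by exact_mod_cast hN
  -- As `e < 3 ≤ N`, the logarithm absorbs the additive constants.
  have hlog1 : 1 ≤ Real.log N := by
    rw [Real.le_log_iff_exp_le (by linarith)]
    linarith [Real.exp_one_lt_d9]
  have hb : (Nat.log 2 N : ℝ) ≤ 2 * Real.log N := by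
    have h1 : ((2 : ℝ) ^ Nat.log 2 N) ≤ N := by exact_mod_cast Nat.pow_log_le_self 2 (by omega)
    have h2 := Real.log_le_log (by positivity) h1
    rw [Real.log_pow] at h2
    have := Real.log_two_gt_d9
    nlinarith [(Nat.cast_nonneg (Nat.log 2 N) : (0 : ℝ) ≤ _)]
  push_cast
  have hd : (0 : ℝ) ≤ d := Nat.cast_nonneg d
  nlinarith [mul_nonneg (sub_nonneg.mpr hK') hd,
    mul_nonneg (sub_nonneg.mpr hK') (sub_nonneg.mpr hlog1)]

end Dimension

/-! ### The two working layers and the idle layer -/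

section Layers

variable {d b K m ℓ D : ℕ} (E : Coord d b K ≃ Fin D)

/-- A layer that copies, at the equals signs and at the labels, the inputs relevant to the tasks,
and then approximates a continuous function `F` of these inputs and of the token. -/
theorem exists_selectLayer (hm : m < 2 ^ b) (hℓ : ℓ + 2 ≤ 2 ^ b) (causal : Bool)
    (place : Fin K → Fin ℓ) (F : (Fin K × Fin d ⊕ Fin d → ℝ) → Fin K → ℝ) (hF : Continuous F)
    (hF01 : ∀ x k, F x k ∈ Set.Icc 0 1) {M δ : ℝ} (hM : 0 ≤ M) (hδ : 0 < δ) :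
    ∃ lay : TransformerLayer D K, ∀ X : Fin (promptLength m ℓ) → Fin D → ℝ,
      CarriesPositions E X → (∀ t c, |X t (E (.token c))| ≤ M) →
      (∀ t p, X t (E (.selected p)) = 0) → (∀ t k, X t (E (.indicator k)) = 0) →
      CarriesPositions E (lay.apply causal X) ∧
      (∀ t k, lay.apply causal X t (E (.identifier k)) = X t (E (.identifier k))) ∧
      (∀ t p, lay.apply causal X t (E (.prediction p)) = X t (E (.prediction p))) ∧
      (∀ t c, lay.apply causal X t (E (.combined c)) = X t (E (.combined c))) ∧
      (∀ t k, |lay.apply causal X t (E (.indicator k))| ≤ 1 + δ) ∧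
      ∀ t : Fin (promptLength m ℓ), ℓ ≤ t.val % (ℓ + 2) →
        (∀ p, |lay.apply causal X t (E (.selected p))
          - X (sourcePosition (place p.1) t) (E (.token p.2))| ≤ δ) ∧
        ∀ k, |lay.apply causal X t (E (.indicator k))
          - F (Sum.elim (fun p => X (sourcePosition (place p.1) t) (E (.token p.2)))
              fun c => X t (E (.token c))) k| ≤ δ := by
  obtain ⟨η, hη, N, W₁, b₁, W₂, hzero, hnet⟩ := exists_feedForward
    (Sum.elim (fun p => E (.selected p)) (fun c => E (.token c)))
    (fun k : Fin K => E (.indicator k)) (fun k k' h => by simpa using h) F hF M hδ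
  -- The tolerance `η` is what the network accepts at its input; `δ` is the accuracy required of the
  -- copies themselves.
  obtain ⟨β, hβ⟩ := (eventually_select hm hℓ causal place hM (lt_min hη hδ)).exists
  refine ⟨⟨fun k => selectHead E β (place k) k, N, W₁, b₁, W₂, 0⟩, ?_⟩
  intro X hX htok hsel hind
  set lay : TransformerLayer D K := ⟨fun k => selectHead E β (place k) k, N, W₁, b₁, W₂, 0⟩
  set Z := lay.attention causal X with hZ
  have happly : ∀ t i, lay.apply causal X t i
      = Z t i + W₂.mulVec (fun a => max 0 (W₁.mulVec (Z t) a + b₁ a)) i := by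
    intro t i
    simp [TransformerLayer.apply, TransformerLayer.feedForward, lay, hZ]
  have hkeep : ∀ t (j : Coord d b K), (∀ k : Fin K, selectValue k j = 0) →
      Z t (E j) = X t (E j) := by
    intro t j hj
    rw [hZ, attention_apply, Finset.sum_eq_zero, add_zero]
    exact fun k _ => selectHead_out_of_value_eq_zero E causal β _ k X t j (hj k)
  have hkeep' : ∀ t (j : Coord d b K), (∀ k : Fin K, selectValue k j = 0) →
      (∀ k, j ≠ .indicator k) → lay.apply causal X t (E j) = X t (E j) := by
    intro t j hj hne
    rw [happly, hzero, add_zero, hkeep t j hj]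
    rintro ⟨k, hk⟩
    exact hne k (E.injective hk).symm
  have hZsel : ∀ t p, Z t (E (.selected p)) = ∑ s ∈ attended causal t,
      Real.exp (β * selectScore b ℓ (place p.1) t s) / (∑ r ∈ attended causal t,
        Real.exp (β * selectScore b ℓ (place p.1) t r)) * X s (E (.token p.2)) := by
    intro t p
    rw [hZ, attention_apply, hsel, zero_add]
    simp only [lay, selectHead_out_selected E causal β _ _ hX]
    rw [Finset.sum_ite_eq]
    simp
  have hYsel : ∀ t p, lay.apply causal X t (E (.selected p)) = Z t (E (.selected p)) := by
    intro t p
    rw [happly, hzero, add_zero]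
    rintro ⟨k, hk⟩
    simpa using E.injective hk
  have hZtok : ∀ t c, Z t (E (.token c)) = X t (E (.token c)) := fun t c =>
    hkeep t _ fun _ => rfl
  have hYind : ∀ t k, lay.apply causal X t (E (.indicator k))
      = W₂.mulVec (fun a => max 0 (W₁.mulVec (Z t) a + b₁ a)) (E (.indicator k)) := by
    intro t k
    rw [happly, hkeep t _ (fun _ => rfl), hind, zero_add]
  refine ⟨?_, fun t k => hkeep' t _ (fun _ => rfl) (by simp),
    fun t k => hkeep' t _ (fun _ => rfl) (by simp),
    fun t k => hkeep' t _ (fun _ => rfl) (by simp), ?_, ?_⟩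
  · intro t i
    rw [hkeep' t _ (fun _ => rfl) (by simp), hX]
  · intro t k
    rw [hYind]
    -- The network is compared with `F` at its actual input, since at ordinary tokens there is no
    -- ideal one; `F` takes values in `[0, 1]`, whence `1 + δ`.
    have h1 := hnet (Z t)
      (Sum.elim (fun p => Z t (E (.selected p))) fun c => Z t (E (.token c))) (by
        rintro (p | c)
        · simp only [Sum.elim_inl, hZsel]
          exact abs_softmax_average_le _ _ ⟨t, mem_attended_of_le causal le_rfl⟩ _
            fun s _ => htok s p.2
        · simpa [hZtok] using htok t c) (by rintro (p | c) <;> simp [hη.le]) k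
    have h2 := hF01 (Sum.elim (fun p => Z t (E (.selected p))) fun c => Z t (E (.token c))) k
    have h1' := abs_le.mp h1
    rw [abs_le]
    constructor <;> linarith [h2.1, h2.2]
  · intro t ht
    have hclose : ∀ p, |Z t (E (.selected p))
        - X (sourcePosition (place p.1) t) (E (.token p.2))| ≤ min η δ := by
      intro p
      rw [hZsel]
      exact hβ p.1 t ht (fun s => X s (E (.token p.2))) fun s => htok s p.2
    refine ⟨fun p => ?_, fun k => ?_⟩
    · rw [hYsel]
      exact (hclose p).trans (min_le_right _ _)
    · rw [hYind]
      refine hnet (Z t) _ ?_ ?_ k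
      · rintro (p | c)
        · exact htok _ _
        · exact htok _ _
      · rintro (p | c)
        · exact (hclose p).trans (min_le_left _ _)
        · simp [hZtok, hη.le]

/-- A layer that averages, at the final position, the indicators over the labels, and then
approximates a continuous function `F` of the averages and of the selected inputs. -/
theorem exists_averageLayer (hm : 1 ≤ m) (causal : Bool)
    (F : (Fin K ⊕ Fin K × Fin d → ℝ) → Fin K × Fin d ⊕ Fin d → ℝ) (hF : Continuous F)
    (M : ℝ) {ε : ℝ} (hε : 0 < ε) :
    ∃ δ > 0, δ ≤ 1 ∧ ∃ lay : TransformerLayer D K, ∀ X : Fin (promptLength m ℓ) → Fin D → ℝ,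
      CarriesPositions E X → (∀ t k, |X t (E (.indicator k))| ≤ 2) →
      (∀ t k, X t (E (.identifier k)) = 0) → (∀ t p, X t (E (.prediction p)) = 0) →
      (∀ t c, X t (E (.combined c)) = 0) →
      ∀ u : Fin K ⊕ Fin K × Fin d → ℝ, (∀ i, |u i| ≤ M) →
      (∀ k, |(∑ j : Fin m, X (labelPosition j) (E (.indicator k))) / m - u (.inl k)| ≤ δ) →
      (∀ p, |X (lastPosition m ℓ) (E (.selected p)) - u (.inr p)| ≤ δ) →
      (∀ k, |lay.apply causal X (lastPosition m ℓ) (E (.identifier k)) - u (.inl k)| ≤ ε) ∧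
      (∀ p, |lay.apply causal X (lastPosition m ℓ) (E (.prediction p)) - F u (.inl p)| ≤ ε) ∧
      (∀ c, |lay.apply causal X (lastPosition m ℓ) (E (.combined c)) - F u (.inr c)| ≤ ε) := by
  obtain ⟨η, hη, N, W₁, b₁, W₂, hzero, hnet⟩ := exists_feedForward
    (Sum.elim (fun k => E (.identifier k)) (fun p => E (.selected p)))
    (Sum.elim (fun p => E (.prediction p)) (fun c => E (.combined c)))
    (by rintro (p | c) (p' | c') h <;> simp_all) F hF M hε
  set θ := min (min η ε) 1 with hθ
  have hθ0 : 0 < θ := lt_min (lt_min hη hε) one_pos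
  have hθη : θ ≤ η := (min_le_left _ _).trans (min_le_left _ _)
  have hθε : θ ≤ ε := (min_le_left _ _).trans (min_le_right _ _)
  -- Half of `θ` goes to the softmax and half to the incoming averages. The bound `2` is the one
  -- assumed on the indicators.
  obtain ⟨β, hβ⟩ := (eventually_average (m := m) (ℓ := ℓ) hm causal (M := 2) (by norm_num)
    (half_pos hθ0)).exists
  refine ⟨θ / 2, half_pos hθ0, by linarith [min_le_right (min η ε) 1],
    ⟨fun k => averageHead E β k, N, W₁, b₁, W₂, 0⟩, ?_⟩
  intro X hX hind hid hpred hcomb u hu havg hsel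
  set lay : TransformerLayer D K := ⟨fun k => averageHead E β k, N, W₁, b₁, W₂, 0⟩
  set t := lastPosition m ℓ
  set Z := lay.attention causal X with hZ
  have happly : ∀ i, lay.apply causal X t i
      = Z t i + W₂.mulVec (fun a => max 0 (W₁.mulVec (Z t) a + b₁ a)) i := by
    intro i
    simp [TransformerLayer.apply, TransformerLayer.feedForward, lay, hZ]
  have hkeep : ∀ j : Coord d b K, (∀ k : Fin K, averageValue k j = 0) →
      Z t (E j) = X t (E j) := by
    intro j hj
    rw [hZ, attention_apply, Finset.sum_eq_zero, add_zero]
    exact fun k _ => averageHead_out_of_value_eq_zero E causal β k X t j (hj k)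
  have hZid : ∀ k, |Z t (E (.identifier k)) - u (.inl k)| ≤ θ := by
    intro k
    rw [hZ, attention_apply, hid, zero_add]
    simp only [lay, averageHead_out_identifier E causal β _ hX]
    rw [Finset.sum_ite_eq, if_pos (Finset.mem_univ _)]
    have h1 := hβ (fun s => X s (E (.indicator k))) fun s => hind s k
    exact (abs_sub_le _ _ _).trans ((add_le_add h1 (havg k)).trans (by linarith))
  have hZsel : ∀ p, Z t (E (.selected p)) = X t (E (.selected p)) := fun p =>
    hkeep _ fun _ => rfl
  have hout := hnet (Z t) u hu (by
    rintro (k | p)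
    · exact (hZid k).trans hθη
    · simp only [Sum.elim_inr, hZsel]
      exact (hsel p).trans (by linarith))
  refine ⟨fun k => ?_, fun p => ?_, fun c => ?_⟩
  · rw [happly, hzero, add_zero]
    · exact (hZid k).trans hθε
    · rintro ⟨p | c, hk⟩ <;> simpa using E.injective hk
  · rw [happly, hkeep _ (fun _ => rfl), hpred, zero_add]
    exact hout (.inl p)
  · rw [happly, hkeep _ (fun _ => rfl), hcomb, zero_add]
    exact hout (.inr c)

/-- The layer that does nothing. -/
def idleLayer (D H : ℕ) : TransformerLayer D H where
  head := fun _ => ⟨0, 0, 0⟩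
  width := 0
  W₁ := 0
  b₁ := 0
  W₂ := 0
  b₂ := 0

theorem idleLayer_apply {D H L : ℕ} (causal : Bool) (X : Fin L → Fin D → ℝ) :
    (idleLayer D H).apply causal X = X := by
  funext t
  simp [TransformerLayer.apply, TransformerLayer.feedForward, TransformerLayer.attention,
    AttentionHead.out, idleLayer]
  exact Matrix.zero_mulVec _

end Layers

/-! ### Continuous maps realized by the feed-forward networks -/

section Tasks

variable {d K ℓ : ℕ}

/-- The answers of the tasks, extended continuously from the cube `[-R, R]^d`. -/
def VecTask.clampedFn (R : ℝ) (g : VecTask d ℓ) (x : Fin d → ℝ) : Fin d → ℝ :=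
  g.fn (clampCube R x)

/-- Task functions are continuous on the cube only, whereas perturbed inputs may leave it; clamping
gives a globally continuous function with the same values on the cube. -/
theorem VecTask.continuous_clampedFn {R : ℝ} (hR : 0 ≤ R) {g : VecTask d ℓ}
    (hg : ContinuousOn g.fn (cube d R)) : Continuous (g.clampedFn R) :=
  hg.comp_continuous (continuous_clampCube R) (clampCube_mem_cube hR)

/-- The soft indicators as functions of the selected inputs and of the label. -/
noncomputable def indicatorMap (R τ : ℝ) (g : Fin K → VecTask d ℓ)
    (x : Fin K × Fin d ⊕ Fin d → ℝ) (k : Fin K) : ℝ :=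
  softIndicator τ (∑ c, |(g k).clampedFn R (fun c' => x (.inl (k, c'))) c - x (.inr c)|)

theorem continuous_indicatorMap {R : ℝ} (hR : 0 ≤ R) (τ : ℝ) {g : Fin K → VecTask d ℓ}
    (hg : ∀ k, ContinuousOn (g k).fn (cube d R)) : Continuous (indicatorMap R τ g) := by
  refine continuous_pi fun k => (continuous_softIndicator τ).comp ?_
  have h := VecTask.continuous_clampedFn hR (hg k)
  refine continuous_finsetSum _ fun c _ => Continuous.abs (Continuous.sub ?_ (by fun_prop))
  exact (continuous_apply c).comp (h.comp (by fun_prop))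

/-- The weighted predictions and their sum as functions of the identifiers and of the selected
inputs. -/
noncomputable def predictionMap (R : ℝ) (w : ℝ → ℝ) (g : Fin K → VecTask d ℓ)
    (x : Fin K ⊕ Fin K × Fin d → ℝ) : Fin K × Fin d ⊕ Fin d → ℝ :=
  Sum.elim
    (fun p => w (x (.inl p.1)) * (g p.1).clampedFn R (fun c => x (.inr (p.1, c))) p.2)
    (fun c => ∑ k, w (x (.inl k)) * (g k).clampedFn R (fun c => x (.inr (k, c))) c)

theorem continuous_predictionMap {R : ℝ} (hR : 0 ≤ R) {w : ℝ → ℝ} (hw : Continuous w)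
    {g : Fin K → VecTask d ℓ} (hg : ∀ k, ContinuousOn (g k).fn (cube d R)) :
    Continuous (predictionMap R w g) := by
  have hterm : ∀ (k : Fin K) (c : Fin d), Continuous fun x : Fin K ⊕ Fin K × Fin d → ℝ =>
      w (x (.inl k)) * (g k).clampedFn R (fun c => x (.inr (k, c))) c := by
    intro k c
    have h := VecTask.continuous_clampedFn hR (hg k)
    exact (hw.comp (continuous_apply _)).mul ((continuous_apply c).comp (h.comp (by fun_prop)))
  refine continuous_pi ?_
  rintro (p | c)
  · exact hterm p.1 p.2
  · exact continuous_finsetSum Finset.univ fun k _ => hterm k c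

end Tasks

/-! ### Assembly of the transformer -/

theorem theorem1 :
    ∃ C : ℝ, 0 < C ∧
      -- `K` tasks on `ℝ^d`; `m` examples, each of length `n = ℓ + 2`
      ∀ (K d m ℓ : ℕ), 1 ≤ K → 1 ≤ m →
      -- bounds on the prompt, the tasks, and the fixed vector that stands for the equals sign
      ∀ (R B : ℝ), 0 < R → 0 < B →
      ∀ (g : Fin K → VecTask d ℓ), (∀ k, ContinuousOn (g k).fn (cube d R)) →
      ∀ (e : Fin d → ℝ),
      -- sharpness of the soft indicators, accuracy, weighting, causal masking or none
      ∀ (τ ε : ℝ), 0 < τ → 0 < ε →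
      ∀ (w : ℝ → ℝ), (w = softmaxWeight ∨ w = fun p => p) →
      ∀ (causal : Bool),
      ∃ (D : ℕ) (T : Transformer 7 D K (promptLength m ℓ) (Fin d ⊕ Unit))
        (identifierRow : Fin K → Fin D) (predictionRow : Fin K → Fin d → Fin D)
        (combinedRow : Fin d → Fin D),
        (D : ℝ) ≤ C * K * (d + Real.log (m * (ℓ + 2))) ∧
        (∀ t i, T.position t i = -1 ∨ T.position t i = 0 ∨ T.position t i = 1) ∧
        ∀ P : Prompt d m ℓ, P.BoundedBy R B →
          -- the task identifiers
          (∀ k, |T.run causal (P.tokens e) (lastPosition m ℓ) (identifierRow k)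
              - (g k).softProportion τ P| ≤ ε) ∧
          -- the weighted prediction of each task
          (∀ k c, |T.run causal (P.tokens e) (lastPosition m ℓ) (predictionRow k c)
              - w ((g k).softProportion τ P) * (g k).answer P.query c| ≤ ε) ∧
          -- the superposition of the predictions
          (∀ c, |T.run causal (P.tokens e) (lastPosition m ℓ) (combinedRow c)
              - ∑ k, w ((g k).softProportion τ P) * (g k).answer P.query c| ≤ ε) ∧
          -- where the labels decide the task up to `1 / τ`, the weights are true proportions
          (∀ k, (∀ j, P.label j = (g k).answer (P.input j) ∨ 1 / τ ≤ (g k).discrepancy P j) →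
              (g k).softProportion τ P = (g k).proportion P) := by
  refine ⟨10, by norm_num, ?_⟩
  intro K d m ℓ hK hm R B hR hB g hg e τ ε hτ hε w hw causal
  have hplace : 1 ≤ ℓ := by
    have := (g ⟨0, hK⟩).place.2
    omega
  have hN : 3 ≤ m * (ℓ + 2) := by nlinarith
  set b := Nat.log 2 (m * (ℓ + 2)) + 1
  have hpow : m * (ℓ + 2) < 2 ^ b := Nat.lt_pow_succ_log_self (by norm_num) _
  have hmb : m < 2 ^ b := lt_of_le_of_lt (by nlinarith) hpow
  have hℓb : ℓ + 2 ≤ 2 ^ b := le_trans (by nlinarith) hpow.le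
  have hwc : Continuous w := by
    rcases hw with rfl | rfl
    · exact continuous_softmaxWeight
    · exact continuous_id
  let E : Coord d b K ≃ Fin (Fintype.card (Coord d b K)) := Fintype.equivFin _
  -- The second layer is built first: its input tolerance `δ` is the accuracy demanded of the first.
  -- Its ideal inputs are identifiers in `[0, 1]` and query entries in `[-R, R]`, hence `max R 1`.
  obtain ⟨δ, hδ, hδ1, lay₂, hlay₂⟩ := exists_averageLayer (m := m) (ℓ := ℓ) E hm causal
    (predictionMap R w g) (continuous_predictionMap hR.le hwc hg) (max R 1) hε
  have he0 : 0 ≤ ∑ c, |e c| := Finset.sum_nonneg fun _ _ => abs_nonneg _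
  obtain ⟨lay₁, hlay₁⟩ := exists_selectLayer E hmb hℓb causal (fun k => (g k).place)
    (indicatorMap R τ g) (continuous_indicatorMap hR.le τ hg)
    (fun x k => ⟨softIndicator_nonneg _ _, softIndicator_le_one hτ.le
      (Finset.sum_nonneg fun c _ => abs_nonneg _)⟩)
    -- Attention also sees the equals signs, so the bound on tokens must include `e`.
    (M := R + B + ∑ c, |e c|) (by positivity) hδ
  -- The equals flag is dropped; positions are recognized by the encodings alone.
  let embed : Coord d b K → Fin d ⊕ Unit → ℝ :=
    Sum.elim (fun c => Pi.single (Sum.inl c) 1) fun _ => 0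
  refine ⟨_, ⟨fun i => embed (E.symm i), fun t i => positionCode ℓ t (E.symm i),
    ![lay₁, lay₂, idleLayer _ _, idleLayer _ _, idleLayer _ _, idleLayer _ _, idleLayer _ _]⟩,
    fun k => E (.identifier k), fun k c => E (.prediction (k, c)), fun c => E (.combined c),
    ?_, fun t i => positionCode_mem t _, ?_⟩
  · have := card_coord_le (d := d) hK hN
    push_cast at this
    exact this
  intro P hP
  set X : Fin (promptLength m ℓ) → Fin (Fintype.card (Coord d b K)) → ℝ := fun t =>
    Matrix.mulVec (fun i => embed (E.symm i)) (P.tokens e t) +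
      fun i => positionCode ℓ t (E.symm i) with hXdef
  have hrun : Transformer.run causal ⟨fun i => embed (E.symm i),
      fun t i => positionCode ℓ t (E.symm i), ![lay₁, lay₂, idleLayer _ _, idleLayer _ _,
        idleLayer _ _, idleLayer _ _, idleLayer _ _]⟩ (P.tokens e)
      = lay₂.apply causal (lay₁.apply causal X) := by
    simp [Transformer.run, List.ofFn_succ, idleLayer_apply, hXdef]
  rw [hrun]
  have hX : ∀ t i, X t (E i) = (∑ j, embed i j * P.tokens e t j) + positionCode ℓ t i := by
    intro t i
    simp [hXdef, Matrix.mulVec, dotProduct]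
  have hXpos : CarriesPositions E X := fun t i => by
    rw [hX]
    simp [embed]
  have hXtok : ∀ t c, X t (E (.token c)) = P.tokens e t (Sum.inl c) := by
    intro t c
    rw [hX]
    simp [embed, positionCode, Pi.single_apply]
  have hXsel : ∀ t p, X t (E (.selected p)) = 0 := fun t p => by
    rw [hX]
    simp [embed, positionCode]
  have hXind : ∀ t k, X t (E (.indicator k)) = 0 := fun t k => by
    rw [hX]
    simp [embed, positionCode]
  have hXid : ∀ t k, X t (E (.identifier k)) = 0 := fun t k => by
    rw [hX]
    simp [embed, positionCode]
  have hXpred : ∀ t p, X t (E (.prediction p)) = 0 := fun t p => by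
    rw [hX]
    simp [embed, positionCode]
  have hXcomb : ∀ t c, X t (E (.combined c)) = 0 := fun t c => by
    rw [hX]
    simp [embed, positionCode]
  obtain ⟨hYpos, hYid, hYpred, hYcomb, hYind, hYgood⟩ := hlay₁ X hXpos
    (fun t c => by rw [hXtok]; exact hP.abs_tokens_le hR.le hB.le e t c) hXsel hXind
  have hm0 : (0 : ℝ) < m := by exact_mod_cast hm
  have hindicator : ∀ k (j : Fin m),
      |lay₁.apply causal X (labelPosition j) (E (.indicator k))
        - softIndicator τ ((g k).discrepancy P j)| ≤ δ := by
    intro k j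
    have hmod : (labelPosition (ℓ := ℓ) j).val % (ℓ + 2) = ℓ + 1 := block_mod (by omega)
    have h := (hYgood (labelPosition j) (by omega)).2 k
    simp only [hXtok, tokens_sourcePosition_labelPosition, tokens_labelPosition] at h
    convert h using 3
    simp only [indicatorMap, Sum.elim_inl, Sum.elim_inr, VecTask.clampedFn, VecTask.discrepancy,
      VecTask.answer]
    -- The ideal inputs lie in the cube, where clamping has no effect.
    rw [clampCube_eq_self (show P.input j (g k).place ∈ cube d R from fun c => hP.1 _ _ c)]
  have hlast : (lastPosition m ℓ).val % (ℓ + 2) = ℓ := block_mod (by omega)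
  obtain ⟨hid, hpred, hcomb⟩ := hlay₂ (lay₁.apply causal X) hYpos
    (fun t k => (hYind t k).trans (by linarith))
    (fun t k => (hYid t k).trans (hXid t k)) (fun t p => (hYpred t p).trans (hXpred t p))
    (fun t c => (hYcomb t c).trans (hXcomb t c))
    (Sum.elim (fun k => (g k).softProportion τ P) fun p => P.query (g p.1).place p.2)
    (by
      rintro (k | p)
      · have := VecTask.softProportion_mem_Icc hτ.le hm (g k) P
        simp only [Sum.elim_inl]
        rw [abs_of_nonneg this.1]
        exact this.2.trans (le_max_right _ _)
      · exact (hP.2.1 _ _).trans (le_max_left _ _))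
    (by
      intro k
      rw [Sum.elim_inl, VecTask.softProportion, ← sub_div, ← Finset.sum_sub_distrib, abs_div,
        abs_of_pos hm0, div_le_iff₀ hm0]
      refine (Finset.abs_sum_le_sum_abs _ _).trans
        ((Finset.sum_le_sum fun j _ => hindicator k j).trans ?_)
      simp [mul_comm])
    (by
      intro p
      have h := (hYgood (lastPosition m ℓ) hlast.ge).1 p
      rwa [hXtok, tokens_sourcePosition_lastPosition] at h)
  have hquery : ∀ k, (g k).clampedFn R (fun c => P.query (g k).place c)
      = (g k).answer P.query := fun k => by
    rw [VecTask.clampedFn, clampCube_eq_self (fun c => hP.2.1 _ c)]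
    rfl
  refine ⟨hid, fun k c => ?_, fun c => ?_,
    fun k hk => VecTask.softProportion_eq_proportion hτ (g k) P hk⟩
  · have h := hpred (k, c)
    simpa only [predictionMap, Sum.elim_inl, Sum.elim_inr, hquery] using h
  · have h := hcomb c
    simpa only [predictionMap, Sum.elim_inl, Sum.elim_inr, hquery] using h
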